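/- **The calculi.** Formulas of QHC have two types, *problems* (Greek letters) and *propositions* (Roman letters). For each type and each $n\ge 0$ there are countably many $n$-ary logical variables; the only terms are the individual variables. An atomic formula is a logical variable applied to individual variables, or the falsity constant: $\bot$, an atomic problem, or $0$, an atomic proposition. Each of $\land,\lor,\to,\exists,\forall$ applies to formulas of one type and yields a formula of that type (it is called *intuitionistic* on problems and *classical* on propositions); $!$ turns a proposition $p$ into a problem $!p$; $?$ turns a problem $\alpha$ into a proposition $?\alpha$. Negation abbreviates implication of the falsity constant of the same type, and $A\leftrightarrow B$ abbreviates $(A\to B)\land(B\to A)$. Formulas are considered up to renaming of bound variables. Provability $\vdash$ in QHC is generated by the axiom schemes and inference rules of classical predicate logic for all propositions, those of intuitionistic predicate logic for all problems, the schemes $$?(\alpha\land\beta)\leftrightarrow(?\alpha\land ?\beta),\quad ?(\alpha\lor\beta)\leftrightarrow(?\alpha\lor ?\beta),\quad ?(\alpha\to\beta)\to(?\alpha\to ?\beta),\quad \neg ?\bot,$$ $$?\exists x\,\alpha(x)\leftrightarrow\exists x\,?\alpha(x),\quad ?\forall x\,\alpha(x)\to\forall x\,?\alpha(x),$$ $$\neg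 !0,\quad ?!p\to p,\quad !(p\to q)\to(!p\to !q),\quad \alpha\to !?\alpha,$$ and the rules $\alpha\,/\,?\alpha$ and $p\,/\,!p$. Formulas of QH (intuitionistic predicate logic) are the problems of QHC without $?$ and $!$. Formulas of QS4 within QHC are the propositions in which $?$ and $!$ occur only in the combination $\Box=\,?!$. **Theorem.** For a formula $A$ of QHC, let $A_\nabla$ be the formula of QHC obtained from $A$ by prefixing atomic problems (including $\bot$) and the intuitionistic connectives $\lor$ and $\exists$ by $!?$; it has the same type as $A$. Then: 1. for every formula $A$ of QHC, $\vdash A$ implies $\vdash A_\nabla$; 2. for every formula $A$ of QH, $\vdash A_\nabla$ implies $\vdash A$; 3. for every formula $A$ of QS4, $\vdash A_\nabla$ implies $\vdash A$; 4. consequently, $A\mapsto A_\nabla$ restricts to a type-preserving embedding of QH into QHC: a formula $A$ of QH is provable in QH if and only if $A_\nabla$ is provable in QHC. -/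

import Mathlib

/-!
Syntax and provability for the joint logic QHC of problems and propositions, and for
intuitionistic predicate logic QH.

The only terms are individual variables, represented by natural numbers. Formulas are taken up to
renaming of bound variables, in the de Bruijn representation: below a quantifier the variable `0`
is the bound one, and `n + 1` is the variable that is called `n` outside of the quantifier.
As all terms are variables, every substitution is a renaming of variables.
-/

/-- The renaming `ρ`, carried under one quantifier. -/
def liftRenaming (ρ : ℕ → ℕ) : ℕ → ℕ
  | 0 => 0
  | n + 1 => ρ n + 1

/-- The renaming that puts the variable `t` for the variable `0` bound by an outermost quantifier,
which is being removed. -/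
def instRenaming (t : ℕ) : ℕ → ℕ
  | 0 => t
  | n + 1 => n

namespace QHC

/-- The two types of formulas of QHC. -/
inductive Kind : Type
  | problem
  | proposition

/-- The formulas of QHC of each type. `atom k n i ts` is the `i`-th `n`-ary logical variable of
type `k`, applied to the individual variables `ts`. `falsum` is `⊥` for problems and `0` for
propositions. The operators from `and` to `ex` are intuitionistic on problems and
classical on propositions. -/
inductive Formula : Kind → Type
  | atom (k : Kind) (n i : ℕ) (ts : Fin n → ℕ) : Formula k
  | falsum (k : Kind) : Formula k
  | and {k : Kind} (A B : Formula k) : Formula k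
  | or {k : Kind} (A B : Formula k) : Formula k
  | imp {k : Kind} (A B : Formula k) : Formula k
  | all {k : Kind} (A : Formula k) : Formula k
  | ex {k : Kind} (A : Formula k) : Formula k
  /-- The problem `! p`: find a proof of `p`. -/
  | bang (p : Formula Kind.proposition) : Formula Kind.problem
  /-- The proposition `? α`: there is a solution of `α`. -/
  | wn (α : Formula Kind.problem) : Formula Kind.proposition

namespace Formula

/-- Negation. -/
def neg {k : Kind} (A : Formula k) : Formula k := imp A (falsum k)

/-- The biconditional. -/
def iff {k : Kind} (A B : Formula k) : Formula k := and (imp A B) (imp B A)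

/-- Renaming of the free individual variables. -/
def rename : {k : Kind} → (ℕ → ℕ) → Formula k → Formula k
  | _, ρ, atom k n i ts => atom k n i (fun j => ρ (ts j))
  | _, _, falsum k => falsum k
  | _, ρ, and A B => and (A.rename ρ) (B.rename ρ)
  | _, ρ, or A B => or (A.rename ρ) (B.rename ρ)
  | _, ρ, imp A B => imp (A.rename ρ) (B.rename ρ)
  | _, ρ, all A => all (A.rename (liftRenaming ρ))
  | _, ρ, ex A => ex (A.rename (liftRenaming ρ))
  | _, ρ, bang p => bang (p.rename ρ)
  | _, ρ, wn α => wn (α.rename ρ)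

/-- For the scope `A(x)` of a quantifier, the formula `A(t)`. -/
def inst {k : Kind} (A : Formula k) (t : ℕ) : Formula k := A.rename (instRenaming t)

/-- The formula `A`, regarded as the scope of a quantifier whose variable is not free in it. -/
def weaken {k : Kind} (A : Formula k) : Formula k := A.rename Nat.succ

/-- `∇ α = ! ? α`. -/
def nabla (α : Formula Kind.problem) : Formula Kind.problem := bang (wn α)

/-- `□ p = ? ! p`. -/
def box (p : Formula Kind.proposition) : Formula Kind.proposition := wn (bang p)

/-- Prefixes problems by `∇`, and leaves propositions as they are. -/
def nablaIfProblem : {k : Kind} → Formula k → Formula k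
  | Kind.problem, α => nabla α
  | Kind.proposition, p => p

/-- The formula `A_∇` (of the same type as `A`): atomic problems, `⊥` included, and the intuitionistic
`∨` and `∃` are prefixed by `! ?`; everything else stays. -/
def nablaTranslation : {k : Kind} → Formula k → Formula k
  | _, atom k n i ts => nablaIfProblem (atom k n i ts)
  | _, falsum k => nablaIfProblem (falsum k)
  | _, and A B => and A.nablaTranslation B.nablaTranslation
  | _, or A B => nablaIfProblem (or A.nablaTranslation B.nablaTranslation)
  | _, imp A B => imp A.nablaTranslation B.nablaTranslation
  | _, all A => all A.nablaTranslation
  | _, ex A => nablaIfProblem (ex A.nablaTranslation)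
  | _, bang p => bang p.nablaTranslation
  | _, wn α => wn α.nablaTranslation

/-- The formulas of QS4 within QHC: propositions in which `?` and `!` occur only in the
combination `□ = ? !`. -/
inductive IsQS4 : Formula Kind.proposition → Prop
  | atom (n i : ℕ) (ts : Fin n → ℕ) : IsQS4 (atom Kind.proposition n i ts)
  | falsum : IsQS4 (falsum Kind.proposition)
  | and {p q : Formula Kind.proposition} : IsQS4 p → IsQS4 q → IsQS4 (and p q)
  | or {p q : Formula Kind.proposition} : IsQS4 p → IsQS4 q → IsQS4 (or p q)
  | imp {p q : Formula Kind.proposition} : IsQS4 p → IsQS4 q → IsQS4 (imp p q)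
  | all {p : Formula Kind.proposition} : IsQS4 p → IsQS4 (all p)
  | ex {p : Formula Kind.proposition} : IsQS4 p → IsQS4 (ex p)
  | box {p : Formula Kind.proposition} : IsQS4 p → IsQS4 (box p)

end Formula

open Formula in
/-- Provability (without hypotheses) in QHC. -/
inductive Provable : {k : Kind} → Formula k → Prop
  -- intuitionistic predicate logic for problems, and the same laws and rules for propositions
  | mp {k : Kind} {A B : Formula k} : Provable (imp A B) → Provable A → Provable B
  | imp_k {k : Kind} (A B : Formula k) : Provable (imp A (imp B A))
  | imp_s {k : Kind} (A B C : Formula k) :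
      Provable (imp (imp A (imp B C)) (imp (imp A B) (imp A C)))
  | and_left {k : Kind} (A B : Formula k) : Provable (imp (and A B) A)
  | and_right {k : Kind} (A B : Formula k) : Provable (imp (and A B) B)
  | and_intro {k : Kind} (A B : Formula k) : Provable (imp A (imp B (and A B)))
  | or_left {k : Kind} (A B : Formula k) : Provable (imp A (or A B))
  | or_right {k : Kind} (A B : Formula k) : Provable (imp B (or A B))
  | or_elim {k : Kind} (A B C : Formula k) :
      Provable (imp (imp A C) (imp (imp B C) (imp (or A B) C)))
  | explosion {k : Kind} (A : Formula k) : Provable (imp (falsum k) A)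
  | all_elim {k : Kind} (A : Formula k) (t : ℕ) : Provable (imp (all A) (A.inst t))
  | ex_intro {k : Kind} (A : Formula k) (t : ℕ) : Provable (imp (A.inst t) (ex A))
  | all_rule {k : Kind} {A B : Formula k} :
      Provable (imp B.weaken A) → Provable (imp B (all A))
  | ex_rule {k : Kind} {A B : Formula k} :
      Provable (imp A B.weaken) → Provable (imp (ex A) B)
  | gen {k : Kind} {A : Formula k} : Provable A → Provable (all A)
  -- excluded middle, for propositions only
  | em (p : Formula Kind.proposition) : Provable (or p (neg p))
  -- laws and rules for `?`
  | wn_and (α β : Formula Kind.problem) : Provable (iff (wn (and α β)) (and (wn α) (wn β)))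
  | wn_or (α β : Formula Kind.problem) : Provable (iff (wn (or α β)) (or (wn α) (wn β)))
  | wn_imp (α β : Formula Kind.problem) : Provable (imp (wn (imp α β)) (imp (wn α) (wn β)))
  | wn_bot : Provable (neg (wn (falsum Kind.problem)))
  | wn_ex (α : Formula Kind.problem) : Provable (iff (wn (ex α)) (ex (wn α)))
  | wn_all (α : Formula Kind.problem) : Provable (imp (wn (all α)) (all (wn α)))
  | wn_top {α : Formula Kind.problem} : Provable α → Provable (wn α)
  -- laws and rules for `!`
  | bang_bot : Provable (neg (bang (falsum Kind.proposition)))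
  | wn_bang (p : Formula Kind.proposition) : Provable (imp (wn (bang p)) p)
  | bang_imp (p q : Formula Kind.proposition) :
      Provable (imp (bang (imp p q)) (imp (bang p) (bang q)))
  | bang_top {p : Formula Kind.proposition} : Provable p → Provable (bang p)
  | bang_wn (α : Formula Kind.problem) : Provable (imp α (bang (wn α)))

end QHC

namespace QH

/-- The formulas of intuitionistic predicate logic QH. -/
inductive Formula : Type
  | atom (n i : ℕ) (ts : Fin n → ℕ) : Formula
  | falsum : Formula
  | and (A B : Formula) : Formula
  | or (A B : Formula) : Formula
  | imp (A B : Formula) : Formula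
  | all (A : Formula) : Formula
  | ex (A : Formula) : Formula

namespace Formula

/-- Renaming of the free individual variables. -/
def rename : (ℕ → ℕ) → Formula → Formula
  | ρ, atom n i ts => atom n i (fun j => ρ (ts j))
  | _, falsum => falsum
  | ρ, and A B => and (A.rename ρ) (B.rename ρ)
  | ρ, or A B => or (A.rename ρ) (B.rename ρ)
  | ρ, imp A B => imp (A.rename ρ) (B.rename ρ)
  | ρ, all A => all (A.rename (liftRenaming ρ))
  | ρ, ex A => ex (A.rename (liftRenaming ρ))

/-- For the scope `A(x)` of a quantifier, the formula `A(t)`. -/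
def inst (A : Formula) (t : ℕ) : Formula := A.rename (instRenaming t)

/-- The formula `A`, regarded as the scope of a quantifier whose variable is not free in it. -/
def weaken (A : Formula) : Formula := A.rename Nat.succ

/-- The inclusion of the formulas of QH in those of QHC, as the problems without `?` and `!`. -/
def toQHC : Formula → QHC.Formula QHC.Kind.problem
  | atom n i ts => QHC.Formula.atom QHC.Kind.problem n i ts
  | falsum => QHC.Formula.falsum QHC.Kind.problem
  | and A B => QHC.Formula.and A.toQHC B.toQHC
  | or A B => QHC.Formula.or A.toQHC B.toQHC
  | imp A B => QHC.Formula.imp A.toQHC B.toQHC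
  | all A => QHC.Formula.all A.toQHC
  | ex A => QHC.Formula.ex A.toQHC

end Formula

open Formula in
/-- Provability (without hypotheses) in QH. -/
inductive Provable : Formula → Prop
  | mp {A B : Formula} : Provable (imp A B) → Provable A → Provable B
  | imp_k (A B : Formula) : Provable (imp A (imp B A))
  | imp_s (A B C : Formula) :
      Provable (imp (imp A (imp B C)) (imp (imp A B) (imp A C)))
  | and_left (A B : Formula) : Provable (imp (and A B) A)
  | and_right (A B : Formula) : Provable (imp (and A B) B)
  | and_intro (A B : Formula) : Provable (imp A (imp B (and A B)))
  | or_left (A B : Formula) : Provable (imp A (or A B))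
  | or_right (A B : Formula) : Provable (imp B (or A B))
  | or_elim (A B C : Formula) :
      Provable (imp (imp A C) (imp (imp B C) (imp (or A B) C)))
  | explosion (A : Formula) : Provable (imp falsum A)
  | all_elim (A : Formula) (t : ℕ) : Provable (imp (all A) (A.inst t))
  | ex_intro (A : Formula) (t : ℕ) : Provable (imp (A.inst t) (ex A))
  | all_rule {A B : Formula} : Provable (imp B.weaken A) → Provable (imp B (all A))
  | ex_rule {A B : Formula} : Provable (imp A B.weaken) → Provable (imp (ex A) B)
  | gen {A : Formula} : Provable A → Provable (all A)

end QH

/-! Write ∇ for `!?`. Translation preserves provability as in a negative translation: each problem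
A_∇ is stable, ∇A_∇ → A_∇ (`nablaIfProblem_nablaTranslation`), so the elimination laws for ⊥, ∨ and
∃ survive the prefixes. QS4 formulas are left unchanged.

Faithfulness on QH is semantic. A frame H embeds in its frame of nuclei by closed nuclei. These are
complemented, so they survive passage to the Boolean frame of regular nuclei. Let `?` be this
embedding and `!` its right adjoint, evaluation at ⊥. Then ∇ is the identity on H
(`restrict_closed_apply_bot`), and A and A_∇ have equal values. If H is the MacNeille completion of
QH formulas under provable implication, a formula has its own principal lower set as value
(`eval_canonicalModel`), so a provable A_∇ forces A to be provable already in QH. -/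

/-! ### Renamings and environments -/

theorem liftRenaming_comp (ρ σ : ℕ → ℕ) :
    liftRenaming (ρ ∘ σ) = liftRenaming ρ ∘ liftRenaming σ := by
  funext n; cases n <;> rfl

theorem liftRenaming_id : liftRenaming id = id := by
  funext n; cases n <;> rfl

theorem comp_instRenaming (ρ : ℕ → ℕ) (t : ℕ) :
    ρ ∘ instRenaming t = instRenaming (ρ t) ∘ liftRenaming ρ := by
  funext n; cases n <;> rfl

theorem liftRenaming_comp_succ (ρ : ℕ → ℕ) : liftRenaming ρ ∘ Nat.succ = Nat.succ ∘ ρ := rfl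

theorem instRenaming_zero_comp_liftRenaming_succ :
    instRenaming 0 ∘ liftRenaming Nat.succ = id := by
  funext n; cases n <;> rfl

/-- The environment `ρ`, shifted by one, with the value `t` at `0`. -/
def consEnv (t : ℕ) (ρ : ℕ → ℕ) : ℕ → ℕ
  | 0 => t
  | n + 1 => ρ n

theorem consEnv_comp_liftRenaming (t : ℕ) (ρ σ : ℕ → ℕ) :
    consEnv t ρ ∘ liftRenaming σ = consEnv t (ρ ∘ σ) := by
  funext n; cases n <;> rfl

theorem comp_instRenaming_eq_consEnv (ρ : ℕ → ℕ) (t : ℕ) :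
    ρ ∘ instRenaming t = consEnv (ρ t) ρ := by
  funext n; cases n <;> rfl

theorem instRenaming_comp_liftRenaming (t : ℕ) (ρ : ℕ → ℕ) :
    instRenaming t ∘ liftRenaming ρ = consEnv t ρ := by
  funext n; cases n <;> rfl

/-! ### Derivations in QHC and preservation of provability -/

namespace QHC

namespace Formula

theorem rename_rename {k : Kind} (A : Formula k) (ρ σ : ℕ → ℕ) :
    (A.rename σ).rename ρ = A.rename (ρ ∘ σ) := by
  induction A generalizing ρ σ <;> simp_all [rename, liftRenaming_comp]

theorem rename_id {k : Kind} (A : Formula k) : A.rename id = A := by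
  induction A <;> simp_all [rename, liftRenaming_id]

theorem inst_zero_rename_liftRenaming_succ {k : Kind} (A : Formula k) :
    (A.rename (liftRenaming Nat.succ)).inst 0 = A := by
  rw [inst, rename_rename, instRenaming_zero_comp_liftRenaming_succ, rename_id]

theorem rename_nablaIfProblem {k : Kind} (A : Formula k) (ρ : ℕ → ℕ) :
    (nablaIfProblem A).rename ρ = nablaIfProblem (A.rename ρ) := by
  cases k <;> rfl

theorem nablaTranslation_rename {k : Kind} (A : Formula k) (ρ : ℕ → ℕ) :
    (A.rename ρ).nablaTranslation = A.nablaTranslation.rename ρ := by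
  induction A generalizing ρ <;>
    simp_all [rename, nablaTranslation, rename_nablaIfProblem]

theorem nablaTranslation_inst {k : Kind} (A : Formula k) (t : ℕ) :
    (A.inst t).nablaTranslation = A.nablaTranslation.inst t :=
  nablaTranslation_rename A _

theorem nablaTranslation_weaken {k : Kind} (A : Formula k) :
    A.weaken.nablaTranslation = A.nablaTranslation.weaken :=
  nablaTranslation_rename A _

/-- Every problem inside a QS4 formula has the form `!p`, so there is nothing to prefix. -/
theorem IsQS4.nablaTranslation_eq {p : Formula Kind.proposition} (h : p.IsQS4) :
    p.nablaTranslation = p := by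
  induction h with
  | atom | falsum => rfl
  | and _ _ ih ih' | or _ _ ih ih' | imp _ _ ih ih' =>
    simp only [nablaTranslation, nablaIfProblem, ih, ih']
  | all _ ih => exact congrArg Formula.all ih
  | ex _ ih => exact congrArg Formula.ex ih
  | box _ ih => exact congrArg Formula.box ih

end Formula

open Formula

namespace Provable

variable {k : Kind} {A B C : Formula k}

theorem weakenHyp (A : Formula k) (h : Provable B) : Provable (imp A B) := mp (imp_k _ _) h

theorem mpUnder (h : Provable (imp A (imp B C))) (h' : Provable (imp A B)) :
    Provable (imp A C) := mp (mp (imp_s _ _ _) h) h'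

theorem refl (A : Formula k) : Provable (imp A A) := mpUnder (imp_k A (imp A A)) (imp_k A A)

theorem trans (h : Provable (imp A B)) (h' : Provable (imp B C)) : Provable (imp A C) :=
  mpUnder (weakenHyp A h') h

theorem imp_mono_right (C : Formula k) (h : Provable (imp A B)) :
    Provable (imp (imp C A) (imp C B)) := mp (imp_s _ _ _) (weakenHyp C h)

theorem imp_mono_left (C : Formula k) (h : Provable (imp A B)) :
    Provable (imp (imp B C) (imp A C)) :=
  mpUnder (trans (imp_k _ _) (imp_s _ _ _)) (weakenHyp _ h)

theorem andI (h : Provable A) (h' : Provable B) : Provable (and A B) :=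
  mp (mp (and_intro _ _) h) h'

theorem iffI (h : Provable (imp A B)) (h' : Provable (imp B A)) : Provable (iff A B) := andI h h'

theorem iff_mp (h : Provable (iff A B)) : Provable (imp A B) := mp (and_left _ _) h

theorem iff_mpr (h : Provable (iff A B)) : Provable (imp B A) := mp (and_right _ _) h

theorem iffTrans (h : Provable (iff A B)) (h' : Provable (iff B C)) : Provable (iff A C) :=
  iffI (trans h.iff_mp h'.iff_mp) (trans h'.iff_mpr h.iff_mpr)

theorem and_under (h : Provable (imp A B)) (h' : Provable (imp A C)) :
    Provable (imp A (and B C)) := mpUnder (trans h (and_intro _ _)) h'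

section Modal

variable {α β : Formula Kind.problem} {p q : Formula Kind.proposition}

theorem wn_mono (h : Provable (imp α β)) : Provable (imp (wn α) (wn β)) :=
  mp (wn_imp _ _) (wn_top h)

theorem bang_mono (h : Provable (imp p q)) : Provable (imp (bang p) (bang q)) :=
  mp (bang_imp _ _) (bang_top h)

theorem nabla_mono (h : Provable (imp α β)) : Provable (imp (nabla α) (nabla β)) :=
  bang_mono (wn_mono h)

theorem nabla_imp (α β : Formula Kind.problem) :
    Provable (imp (nabla (imp α β)) (imp (nabla α) (nabla β))) :=
  trans (bang_mono (wn_imp _ _)) (bang_imp _ _)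

/-- `?` absorbs ∇, so the laws for `?(α ∨ β)` and `?∃` are insensitive to the added prefixes. -/
theorem wn_nabla (α : Formula Kind.problem) : Provable (iff (wn (nabla α)) (wn α)) :=
  iffI (wn_bang _) (wn_mono (bang_wn _))

theorem nabla_bang (p : Formula Kind.proposition) : Provable (imp (nabla (bang p)) (bang p)) :=
  bang_mono (wn_bang _)

end Modal

/-- The formulas `α_∇` are stable under `∇`. -/
theorem nablaIfProblem_nablaTranslation {k : Kind} (A : Formula k) :
    Provable (imp (nablaIfProblem A.nablaTranslation) A.nablaTranslation) := by
  cases k with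
  | proposition => exact refl _
  | problem =>
    generalize hk : Kind.problem = k at A
    induction A with
    | atom | falsum | or | ex => subst hk; exact nabla_bang _
    | bang => exact nabla_bang _
    | wn => cases hk
    | and A B ihA ihB =>
      subst hk
      exact and_under (trans (nabla_mono (and_left _ _)) (ihA rfl))
        (trans (nabla_mono (and_right _ _)) (ihB rfl))
    | imp A B ihA ihB =>
      subst hk
      -- Distribute ∇ over the implication, then use A → ∇A on the left and stability of B on the
      -- right; stability of A is not needed.
      exact trans (trans (nabla_imp _ _) (imp_mono_left _ (bang_wn _)))
        (imp_mono_right _ (ihB rfl))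
    | all A ih =>
      subst hk
      refine all_rule (trans (nabla_mono ?_) (ih rfl))
      -- Under weakening, instantiating the shifted ∀ at the new variable 0 gives back the scope.
      have h := all_elim (A.nablaTranslation.rename (liftRenaming Nat.succ)) 0
      rwa [inst_zero_rename_liftRenaming_succ] at h

theorem imp_nablaIfProblem (A : Formula k) : Provable (imp A (nablaIfProblem A)) := by
  cases k with
  | proposition => exact refl _
  | problem => exact bang_wn _

/-- Since the conclusion is stable, a prefix on the hypothesis can be ignored; this recovers
elimination for the prefixed ⊥, ∨ and ∃. -/
theorem imp_nablaIfProblem_imp (A B : Formula k) :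
    Provable (imp (imp A B.nablaTranslation) (imp (nablaIfProblem A) B.nablaTranslation)) := by
  cases k with
  | proposition => exact refl _
  | problem =>
    exact trans (trans (bang_wn _) (nabla_imp _ _))
      (imp_mono_right _ (nablaIfProblem_nablaTranslation B))

/-- The `∇`-translation preserves provability. -/
theorem nablaTranslation {k : Kind} {A : Formula k} (h : Provable A) :
    Provable A.nablaTranslation := by
  induction h with
  | mp _ _ ih ih' => exact mp ih ih'
  | imp_k => exact imp_k _ _
  | imp_s => exact imp_s _ _ _
  | and_left => exact and_left _ _
  | and_right => exact and_right _ _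
  | and_intro => exact and_intro _ _
  | or_left => exact trans (or_left _ _) (imp_nablaIfProblem _)
  | or_right => exact trans (or_right _ _) (imp_nablaIfProblem _)
  | or_elim A B C =>
    exact trans (or_elim _ _ _) (imp_mono_right _ (imp_nablaIfProblem_imp _ C))
  | explosion A => exact mp (imp_nablaIfProblem_imp _ A) (explosion _)
  | all_elim A t =>
    have h := all_elim A.nablaTranslation t
    rwa [← nablaTranslation_inst] at h
  | ex_intro A t =>
    have h := trans (ex_intro A.nablaTranslation t) (imp_nablaIfProblem _)
    rwa [← nablaTranslation_inst] at h
  | @all_rule _ A B _ ih =>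
    refine all_rule (B := B.nablaTranslation) ?_
    rwa [← nablaTranslation_weaken]
  | @ex_rule _ A B _ ih =>
    refine mp (imp_nablaIfProblem_imp _ B) (ex_rule ?_)
    rwa [← nablaTranslation_weaken]
  | gen _ ih => exact gen ih
  | em => exact em _
  | wn_and => exact wn_and _ _
  | wn_or => exact iffTrans (wn_nabla _) (wn_or _ _)
  | wn_imp => exact wn_imp _ _
  | wn_bot => exact trans (wn_bang _) wn_bot
  | wn_ex => exact iffTrans (wn_nabla _) (wn_ex _)
  | wn_all => exact wn_all _
  | wn_top _ ih => exact wn_top ih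
  | bang_bot => exact trans bang_bot (bang_wn _)
  | wn_bang => exact wn_bang _
  | bang_imp => exact bang_imp _ _
  | bang_top _ ih => exact bang_top ih
  | bang_wn => exact bang_wn _

end Provable

/-! ### Algebraic models and soundness -/

/-- An algebraic model of QHC with the individual variables as its domain: a frame of problems
embedded, by a frame homomorphism with a right adjoint, in a Boolean frame of propositions. -/
structure Model (V : Kind → Type*) [∀ k, Order.Frame (V k)] where
  wn : FrameHom (V Kind.problem) (V Kind.proposition)
  bang : V Kind.proposition → V Kind.problem
  gc : GaloisConnection wn bang
  bang_wn (a : V Kind.problem) : bang (wn a) = a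
  sup_compl (b : V Kind.proposition) : b ⊔ bᶜ = ⊤
  atom (k : Kind) (n i : ℕ) (ts : Fin n → ℕ) : V k

namespace Model

variable {V : Kind → Type*} [∀ k, Order.Frame (V k)] (M : Model V)

/-- The value of a formula in a model. -/
def eval : {k : Kind} → (ℕ → ℕ) → Formula k → V k
  | _, ρ, .atom k n i ts => M.atom k n i (fun j => ρ (ts j))
  | _, _, .falsum _ => ⊥
  | _, ρ, .and A B => eval ρ A ⊓ eval ρ B
  | _, ρ, .or A B => eval ρ A ⊔ eval ρ B
  | _, ρ, .imp A B => eval ρ A ⇨ eval ρ B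
  | _, ρ, .all A => ⨅ t, eval (consEnv t ρ) A
  | _, ρ, .ex A => ⨆ t, eval (consEnv t ρ) A
  | _, ρ, .bang p => M.bang (eval ρ p)
  | _, ρ, .wn α => M.wn (eval ρ α)

theorem eval_rename {k : Kind} (A : Formula k) (ρ σ : ℕ → ℕ) :
    M.eval ρ (A.rename σ) = M.eval (ρ ∘ σ) A := by
  induction A generalizing ρ σ <;> simp_all [rename, eval, consEnv_comp_liftRenaming]

theorem eval_inst {k : Kind} (A : Formula k) (ρ : ℕ → ℕ) (t : ℕ) :
    M.eval ρ (A.inst t) = M.eval (consEnv (ρ t) ρ) A := by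
  rw [inst, eval_rename, comp_instRenaming_eq_consEnv]

theorem eval_weaken {k : Kind} (A : Formula k) (ρ : ℕ → ℕ) (t : ℕ) :
    M.eval (consEnv t ρ) A.weaken = M.eval ρ A := by
  rw [weaken, eval_rename]; rfl

theorem eval_nablaIfProblem {k : Kind} (A : Formula k) (ρ : ℕ → ℕ) :
    M.eval ρ (nablaIfProblem A) = M.eval ρ A := by
  cases k
  · exact M.bang_wn _
  · rfl

theorem eval_nablaTranslation {k : Kind} (A : Formula k) (ρ : ℕ → ℕ) :
    M.eval ρ A.nablaTranslation = M.eval ρ A := by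
  induction A generalizing ρ with
  | atom | falsum => exact M.eval_nablaIfProblem _ _
  | and A B ih ih' | or A B ih ih' | imp A B ih ih' =>
    simp only [Formula.nablaTranslation, eval_nablaIfProblem, eval, ih, ih']
  | all A ih | ex A ih | bang A ih | wn A ih =>
    simp only [Formula.nablaTranslation, eval_nablaIfProblem, eval, ih]

theorem eval_iff_eq_top {k : Kind} {A B : Formula k} {ρ : ℕ → ℕ} :
    M.eval ρ (A.iff B) = ⊤ ↔ M.eval ρ A = M.eval ρ B := by
  rw [Formula.iff, eval, eval, eval, inf_eq_top_iff, himp_eq_top_iff, himp_eq_top_iff,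
    ← le_antisymm_iff]

theorem bang_top : M.bang ⊤ = ⊤ := M.gc.u_top

theorem bang_inf (a b : V Kind.proposition) : M.bang (a ⊓ b) = M.bang a ⊓ M.bang b := M.gc.u_inf

theorem bang_bot : M.bang ⊥ = ⊥ := by rw [← map_bot M.wn, M.bang_wn]

/-- Soundness: `?` preserves finite meets and all joins, while `!`, as a right adjoint, preserves
meets. For `?∀` monotonicity suffices. The environment varies in the induction because the
quantifier rules extend it. -/
theorem eval_eq_top {k : Kind} {A : Formula k} (h : Provable A) (ρ : ℕ → ℕ) :
    M.eval ρ A = ⊤ := by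
  induction h generalizing ρ with
  | mp _ _ ih ih' =>
    have h := ih ρ
    rwa [eval, ih' ρ, top_himp] at h
  | imp_k => simp [eval, himp_eq_top_iff]
  | imp_s A B C =>
    simp only [eval, himp_eq_top_iff, le_himp_iff]
    refine (le_inf ?_ ?_).trans (himp_inf_le (a := M.eval ρ B))
    · exact (inf_le_inf_right _ inf_le_left).trans himp_inf_le
    · exact (inf_le_inf_right _ inf_le_right).trans himp_inf_le
  | and_left => simp [eval]
  | and_right => simp [eval]
  | and_intro => simp [eval]
  | or_left => simp [eval]
  | or_right => simp [eval]
  | or_elim A B C =>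
    simp only [eval, himp_eq_top_iff, le_himp_iff]
    rw [← le_himp_iff, sup_himp_distrib]
  | explosion A => simp [eval]
  | all_elim A t =>
    simp only [eval, himp_eq_top_iff, eval_inst]
    exact iInf_le _ _
  | ex_intro A t =>
    simp only [eval, himp_eq_top_iff, eval_inst]
    exact le_iSup (fun t => M.eval (consEnv t ρ) A) _
  | @all_rule _ A B _ ih =>
    simp only [eval, himp_eq_top_iff] at ih ⊢
    exact le_iInf fun t => by simpa [eval_weaken] using ih (consEnv t ρ)
  | @ex_rule _ A B _ ih =>
    simp only [eval, himp_eq_top_iff] at ih ⊢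
    exact iSup_le fun t => by simpa [eval_weaken] using ih (consEnv t ρ)
  | gen _ ih => simp [eval, ih]
  | em => simp [eval, neg, M.sup_compl]
  | wn_and => simp [eval_iff_eq_top, eval]
  | wn_or => simp [eval_iff_eq_top, eval]
  | wn_imp α β =>
    simp only [eval, himp_eq_top_iff, le_himp_iff, ← map_inf]
    exact OrderHomClass.mono M.wn himp_inf_le
  | wn_bot => simp [eval, neg]
  | wn_ex => simp [eval_iff_eq_top, eval]
  | wn_all =>
    simp only [eval, himp_eq_top_iff]
    exact le_iInf fun t => OrderHomClass.mono M.wn (iInf_le _ t)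
  | wn_top _ ih => simp [eval, ih]
  | bang_bot => simp [eval, neg, M.bang_bot]
  | wn_bang =>
    simp only [eval, himp_eq_top_iff]
    exact M.gc.l_u_le _
  | bang_imp =>
    simp only [eval, himp_eq_top_iff, le_himp_iff, ← bang_inf]
    exact M.gc.monotone_u himp_inf_le
  | bang_top _ ih => simp [eval, ih, M.bang_top]
  | bang_wn => simp [eval, M.bang_wn]

end Model

end QHC

/-! ### Nuclei and regular elements: a Boolean extension of a frame -/

namespace Nucleus

variable {H : Type*} [Order.Frame H]

/-- The closed nucleus of an element of a frame. -/
def closed (a : H) : Nucleus H where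
  toFun x := a ⊔ x
  map_inf' x y := sup_inf_left _ _ _
  idempotent' x := by simp
  le_apply' x := le_sup_right

theorem closed_apply (a x : H) : closed a x = a ⊔ x := rfl

/-- The open nucleus of an element of a frame. -/
def opened (a : H) : Nucleus H where
  toFun x := a ⇨ x
  map_inf' x y := himp_inf_distrib _ _ _
  idempotent' x := by simp
  le_apply' x := le_himp

theorem opened_apply (a x : H) : opened a x = a ⇨ x := rfl

/-- A nucleus is monotone and inflationary, so its value at ⊥ decides. This is the adjunction behind
`?` and `!`, and also shows that `closed` preserves joins. -/
theorem closed_le_iff {a : H} {n : Nucleus H} : closed a ≤ n ↔ a ≤ n ⊥ := by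
  refine ⟨fun h => by simpa [closed_apply] using h ⊥, fun h x => ?_⟩
  exact sup_le (h.trans (n.monotone bot_le)) n.le_apply

theorem isCompl_closed_opened (a : H) : IsCompl (closed a) (opened a) := by
  refine IsCompl.of_le (fun x => ?_) (fun x => ?_)
  · simp [closed_apply, opened_apply, inf_sup_right]
  -- Let n be the join. The closed part gives a ≤ n x, so a ⇨ n x = ⊤; the open part and idempotence
  -- then give ⊤ ≤ n (n x) = n x.
  · have hx : a ≤ (closed a ⊔ opened a) x :=
      (closed_le_iff.1 le_sup_left).trans ((closed a ⊔ opened a).monotone bot_le)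
    have h : opened a ≤ closed a ⊔ opened a := le_sup_right
    rw [← (closed a ⊔ opened a).idempotent]
    refine le_trans ?_ (h _)
    rw [opened_apply, himp_eq_top_iff.2 hx]
    exact le_top

/-- The embedding of a frame in its frame of nuclei. -/
def closedHom (H : Type*) [Order.Frame H] : FrameHom H (Nucleus H) where
  toFun := closed
  map_inf' a b := by ext x; exact sup_inf_right _ _ _
  map_top' := by ext x; simp [closed_apply]
  map_sSup' s := eq_of_forall_ge_iff fun n => by simp [closed_le_iff]

end Nucleus

/-- The sublocale of regular elements of a frame. -/
def regularSublocale (X : Type*) [Order.Frame X] : Sublocale X where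
  carrier := {a | Heyting.IsRegular a}
  sInf_mem' s hs := by
    refine le_antisymm (le_sInf fun a ha => ?_) le_compl_compl
    exact (compl_le_compl (compl_le_compl (sInf_le ha))).trans_eq (hs ha)
  himp_mem' a b hb := by
    have hb : bᶜᶜ = b := hb
    show Heyting.IsRegular (a ⇨ b)
    -- As b = bᶜᶜ, the implication is the complement of the meet of a and bᶜ.
    rw [← hb, ← himp_bot bᶜ, himp_himp, himp_bot]
    exact Heyting.isRegular_compl _

/-- ⊥ is regular, so complements agree with those of X and double complement is the identity; De
Morgan then gives excluded middle. -/
theorem regularSublocale_sup_compl {X : Type*} [Order.Frame X] (b : regularSublocale X) :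
    b ⊔ bᶜ = ⊤ := by
  have hbot : ((⊥ : regularSublocale X) : X) = ⊥ :=
    le_bot_iff.1 (show (⊥ : regularSublocale X) ≤ ⟨⊥, Heyting.isRegular_bot⟩ from bot_le)
  have hreg (c : regularSublocale X) : cᶜᶜ = c := by
    apply Subtype.ext
    rw [← himp_bot, ← himp_bot, Sublocale.coe_himp, Sublocale.coe_himp, hbot, himp_bot, himp_bot]
    exact c.2
  rw [← hreg (b ⊔ bᶜ), compl_sup, inf_compl_self, compl_bot]

theorem restrict_regularSublocale_of_isRegular {X : Type*} [Order.Frame X] {a : X}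
    (h : Heyting.IsRegular a) : ((regularSublocale X).restrict a : X) = a :=
  le_antisymm ((regularSublocale X).giRestrict.gc.l_le (b := ⟨a, h⟩) le_rfl)
    ((regularSublocale X).giRestrict.gc.le_u_l a)

/-- A closed nucleus is complemented, hence regular, hence fixed by the reflection; its value at ⊥
is a ⊔ ⊥. -/
theorem restrict_closed_apply_bot {H : Type*} [Order.Frame H] (a : H) :
    ((regularSublocale (Nucleus H)).restrict (Nucleus.closed a)).1 ⊥ = a := by
  have h := Nucleus.isCompl_closed_opened a
  rw [restrict_regularSublocale_of_isRegular, Nucleus.closed_apply, sup_bot_eq]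
  rw [Heyting.IsRegular, h.compl_eq, h.symm.compl_eq]

namespace QHC

/-- Truth values: `H` for problems, and the regular nuclei of `H` for propositions. -/
def TruthValue (H : Type*) [Order.Frame H] : Kind → Type _
  | Kind.problem => H
  | Kind.proposition => regularSublocale (Nucleus H)

instance (H : Type*) [Order.Frame H] : ∀ k, Order.Frame (TruthValue H k)
  | Kind.problem => inferInstanceAs (Order.Frame H)
  | Kind.proposition => inferInstanceAs (Order.Frame (regularSublocale (Nucleus H)))

/-- The model of QHC on a frame, for a given interpretation of the atomic problems. -/
def Model.ofFrame {H : Type*} [Order.Frame H] (v : (n i : ℕ) → (Fin n → ℕ) → H) :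
    Model (TruthValue H) where
  wn := ((regularSublocale (Nucleus H)).restrict.comp (Nucleus.closedHom H) :)
  bang b := (b : regularSublocale (Nucleus H)).1 ⊥
  gc _ _ := ((regularSublocale (Nucleus H)).giRestrict.gc _ _).trans Nucleus.closed_le_iff
  bang_wn a := restrict_closed_apply_bot (H := H) a
  sup_compl b := regularSublocale_sup_compl b
  atom
    | Kind.problem => v
    -- An arbitrary choice: no atomic proposition occurs in a QH formula.
    | Kind.proposition => fun _ _ _ => ⊤

end QHC

/-! ### Renaming and fresh variables in QH -/

namespace QH

namespace Formula

theorem rename_rename (A : Formula) (ρ σ : ℕ → ℕ) :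
    (A.rename σ).rename ρ = A.rename (ρ ∘ σ) := by
  induction A generalizing ρ σ <;> simp_all [rename, liftRenaming_comp]

theorem rename_id (A : Formula) : A.rename id = A := by
  induction A <;> simp_all [rename, liftRenaming_id]

theorem rename_inst (A : Formula) (t : ℕ) (ρ : ℕ → ℕ) :
    (A.inst t).rename ρ = (A.rename (liftRenaming ρ)).inst (ρ t) := by
  rw [inst, inst, rename_rename, rename_rename, comp_instRenaming]

theorem rename_weaken (A : Formula) (ρ : ℕ → ℕ) :
    A.weaken.rename (liftRenaming ρ) = (A.rename ρ).weaken := by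
  rw [weaken, weaken, rename_rename, rename_rename, liftRenaming_comp_succ]

theorem exists_forall_rename_eq (A : Formula) :
    ∃ N, ∀ ρ σ : ℕ → ℕ, (∀ n < N, ρ n = σ n) → A.rename ρ = A.rename σ := by
  -- Lifting keeps agreement below N, so a bound for the scope also serves the quantified formula.
  have lift {N : ℕ} {ρ σ : ℕ → ℕ} (h : ∀ n < N, ρ n = σ n) :
      ∀ n < N, liftRenaming ρ n = liftRenaming σ n
    | 0, _ => rfl
    | n + 1, hn => congrArg (· + 1) (h n (by omega))
  induction A with
  | atom n i ts =>
    refine ⟨Finset.univ.sup ts + 1, fun ρ σ h => ?_⟩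
    simp only [rename, atom.injEq, heq_eq_eq, true_and]
    funext j
    exact h _ (Nat.lt_succ_of_le (Finset.le_sup (Finset.mem_univ j)))
  | falsum => exact ⟨0, fun _ _ _ => rfl⟩
  | and A B ihA ihB | or A B ihA ihB | imp A B ihA ihB =>
    obtain ⟨N, hN⟩ := ihA
    obtain ⟨M, hM⟩ := ihB
    refine ⟨max N M, fun ρ σ h => ?_⟩
    rw [rename, rename, hN ρ σ fun n hn => h n (by omega), hM ρ σ fun n hn => h n (by omega)]
  | all A ih | ex A ih =>
    obtain ⟨N, hN⟩ := ih
    exact ⟨N, fun ρ σ h => by rw [rename, rename, hN _ _ (lift h)]⟩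

/-- For a variable `t` that is not free in `A` and `B`, some renaming turns `A(t)` into the scope of a
quantifier and leaves `B` as it is. -/
theorem exists_rename_inst (A B : Formula) :
    ∃ (t : ℕ) (σ : ℕ → ℕ), B.rename σ = B.weaken ∧ (A.inst t).rename σ = A := by
  -- The conjunction gives one bound for both formulas. The renaming sends the fresh N to 0 and
  -- agrees with `Nat.succ` elsewhere.
  obtain ⟨N, hN⟩ := exists_forall_rename_eq (and B (all A))
  refine ⟨N, fun n => if n = N then 0 else n + 1, ?_⟩
  have h := hN (fun n => if n = N then 0 else n + 1) Nat.succ fun n hn => if_neg hn.ne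
  simp only [rename, and.injEq, all.injEq] at h
  refine ⟨h.1, ?_⟩
  rw [rename_inst, h.2, if_pos rfl, inst, rename_rename,
    instRenaming_zero_comp_liftRenaming_succ, rename_id]

theorem toQHC_rename (A : Formula) (ρ : ℕ → ℕ) : (A.rename ρ).toQHC = A.toQHC.rename ρ := by
  induction A generalizing ρ <;> simp_all [rename, toQHC, QHC.Formula.rename]

end Formula

open Formula

namespace Provable

theorem rename {A : Formula} (h : Provable A) (ρ : ℕ → ℕ) : Provable (A.rename ρ) := by
  induction h generalizing ρ with
  | mp _ _ ih ih' => exact mp (ih ρ) (ih' ρ)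
  | imp_k => exact imp_k _ _
  | imp_s => exact imp_s _ _ _
  | and_left => exact and_left _ _
  | and_right => exact and_right _ _
  | and_intro => exact and_intro _ _
  | or_left => exact or_left _ _
  | or_right => exact or_right _ _
  | or_elim => exact or_elim _ _ _
  | explosion => exact explosion _
  | all_elim A t =>
    have h := all_elim (A.rename (liftRenaming ρ)) (ρ t)
    rwa [← rename_inst] at h
  | ex_intro A t =>
    have h := ex_intro (A.rename (liftRenaming ρ)) (ρ t)
    rwa [← rename_inst] at h
  | all_rule _ ih =>
    refine all_rule ?_
    rw [← rename_weaken]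
    exact ih _
  | ex_rule _ ih =>
    refine ex_rule ?_
    rw [← rename_weaken]
    exact ih _
  | gen _ ih => exact gen (ih _)

theorem toQHC {A : Formula} (h : Provable A) : QHC.Provable A.toQHC := by
  induction h with
  | mp _ _ ih ih' => exact .mp ih ih'
  | imp_k => exact .imp_k _ _
  | imp_s => exact .imp_s _ _ _
  | and_left => exact .and_left _ _
  | and_right => exact .and_right _ _
  | and_intro => exact .and_intro _ _
  | or_left => exact .or_left _ _
  | or_right => exact .or_right _ _
  | or_elim => exact .or_elim _ _ _
  | explosion => exact .explosion _
  | all_elim A t =>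
    have h := QHC.Provable.all_elim A.toQHC t
    rwa [QHC.Formula.inst, ← toQHC_rename] at h
  | ex_intro A t =>
    have h := QHC.Provable.ex_intro A.toQHC t
    rwa [QHC.Formula.inst, ← toQHC_rename] at h
  | @all_rule A B _ ih =>
    refine .all_rule (B := B.toQHC) ?_
    rwa [QHC.Formula.weaken, ← toQHC_rename]
  | @ex_rule A B _ ih =>
    refine .ex_rule (B := B.toQHC) ?_
    rwa [QHC.Formula.weaken, ← toQHC_rename]
  | gen _ ih => exact .gen ih

variable {A B C : Formula}

theorem mpUnder (h : Provable (imp A (imp B C))) (h' : Provable (imp A B)) :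
    Provable (imp A C) := mp (mp (imp_s _ _ _) h) h'

theorem trans (h : Provable (imp A B)) (h' : Provable (imp B C)) : Provable (imp A C) :=
  mpUnder (mp (imp_k _ _) h') h

theorem refl (A : Formula) : Provable (imp A A) := mpUnder (imp_k A (imp A A)) (imp_k A A)

theorem and_under (h : Provable (imp A B)) (h' : Provable (imp A C)) :
    Provable (imp A (and B C)) := mpUnder (trans h (and_intro _ _)) h'

theorem uncurry (h : Provable (imp A (imp B C))) : Provable (imp (and A B) C) :=
  mpUnder (trans (and_left _ _) h) (and_right _ _)

theorem curry (h : Provable (imp (and A B) C)) : Provable (imp A (imp B C)) :=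
  trans (and_intro A B) (mp (imp_s _ _ _) (mp (imp_k _ _) h))

/-- The instance at a fresh variable, suitably renamed, is the premise of `all_rule`. Thus ∀ is the
meet of its instances at variables. -/
theorem imp_all_of_forall (h : ∀ t, Provable (imp B (A.inst t))) :
    Provable (imp B (all A)) := by
  obtain ⟨t, σ, hσ⟩ := exists_rename_inst A B
  have h' := (h t).rename σ
  rw [Formula.rename, hσ.1, hσ.2] at h'
  exact all_rule h'

theorem ex_imp_of_forall (h : ∀ t, Provable (imp (A.inst t) B)) :
    Provable (imp (ex A) B) := by
  obtain ⟨t, σ, hσ⟩ := exists_rename_inst A B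
  have h' := (h t).rename σ
  rw [Formula.rename, hσ.1, hσ.2] at h'
  exact ex_rule h'

end Provable

/-! ### The MacNeille completion and the canonical model -/

/-- Formulas are preordered by provable implication. -/
instance : Preorder Formula where
  le A B := Provable (imp A B)
  le_refl := Provable.refl
  le_trans _ _ _ := Provable.trans

theorem le_imp_iff {A B C : Formula} : A ≤ imp B C ↔ and A B ≤ C :=
  ⟨Provable.uncurry, Provable.curry⟩

theorem le_and_iff {A B C : Formula} : A ≤ and B C ↔ A ≤ B ∧ A ≤ C :=
  ⟨fun h => ⟨h.trans (Provable.and_left _ _), h.trans (Provable.and_right _ _)⟩,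
    fun h => Provable.and_under h.1 h.2⟩

theorem or_le_iff {A B C : Formula} : or A B ≤ C ↔ A ≤ C ∧ B ≤ C :=
  ⟨fun h => ⟨le_trans (Provable.or_left _ _) h, le_trans (Provable.or_right _ _) h⟩,
    fun h => .mp (.mp (.or_elim _ _ _) h.1) h.2⟩

theorem le_all_iff {A B : Formula} : B ≤ all A ↔ ∀ t, B ≤ A.inst t :=
  ⟨fun h t => h.trans (Provable.all_elim _ t), Provable.imp_all_of_forall⟩

theorem ex_le_iff {A B : Formula} : ex A ≤ B ↔ ∀ t, A.inst t ≤ B :=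
  ⟨fun h t => le_trans (Provable.ex_intro _ t) h, Provable.ex_imp_of_forall⟩

/-- The MacNeille completion of the preorder of formulas: the lower sets that contain all lower
bounds of their upper bounds. -/
def macNeille : Sublocale (LowerSet Formula) where
  carrier := {X | ∀ A, (∀ B, (∀ C ∈ X, C ≤ B) → A ≤ B) → A ∈ X}
  sInf_mem' s hs A hA := by
    rw [LowerSet.mem_sInf_iff]
    exact fun X hX => hs hX A fun B hB => hA B fun C hC =>
      hB C (LowerSet.mem_sInf_iff.1 hC X hX)
  himp_mem' X Y hY A hA := by
    rw [← LowerSet.Iic_le, le_himp_iff]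
    rintro C ⟨hCA, hCX⟩
    refine hY C fun D hD => ?_
    -- For an upper bound D of Y, C → D bounds X ⇨ Y from above: if E lies in X ⇨ Y, then E ∧ C lies
    -- in Y.
    have h : A ≤ imp C D := hA _ fun E hE => by
      rw [le_imp_iff]
      refine hD _ ?_
      have hle : (X ⇨ Y) ⊓ X ≤ Y := himp_inf_le
      exact hle ⟨(X ⇨ Y).lower (Provable.and_left _ _) hE,
        X.lower (Provable.and_right _ _) hCX⟩
    exact (le_and_iff.2 ⟨hCA, le_rfl⟩).trans (le_imp_iff.1 h)

/-- The element of the MacNeille completion given by a formula. -/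
def principal (A : Formula) : macNeille :=
  ⟨LowerSet.Iic A, fun _ h => h A fun _ hC => hC⟩

theorem le_principal_iff {X : macNeille} {A : Formula} :
    X ≤ principal A ↔ ∀ B ∈ X.1, B ≤ A := Iff.rfl

theorem principal_le_iff {X : macNeille} {A : Formula} : principal A ≤ X ↔ A ∈ X.1 :=
  LowerSet.Iic_le

/-- Membership is tested on upper bounds; this is why ⊥, ∨ and ∃ become joins, which fails for
arbitrary lower sets. -/
theorem mem_iff {X : macNeille} {A : Formula} :
    A ∈ X.1 ↔ ∀ B, (∀ C ∈ X.1, C ≤ B) → A ≤ B :=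
  ⟨fun h _ hB => hB A h, X.2 A⟩

theorem principal_falsum : principal falsum = ⊥ :=
  le_bot_iff.1 (principal_le_iff.2 (mem_iff.2 fun B _ => Provable.explosion B))

theorem principal_and (A B : Formula) : principal (and A B) = principal A ⊓ principal B :=
  eq_of_forall_le_iff fun X => by
    simp only [le_inf_iff, le_principal_iff, le_and_iff, forall_and]

theorem principal_or (A B : Formula) : principal (or A B) = principal A ⊔ principal B :=
  eq_of_forall_ge_iff fun X => by
    rw [sup_le_iff, principal_le_iff, principal_le_iff, principal_le_iff]
    refine ⟨fun h => ⟨X.1.lower (Provable.or_left _ _) h, X.1.lower (Provable.or_right _ _) h⟩,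
      fun h => mem_iff.2 fun C hC => or_le_iff.2 ⟨hC _ h.1, hC _ h.2⟩⟩

theorem principal_imp (A B : Formula) : principal (imp A B) = principal A ⇨ principal B :=
  eq_of_forall_le_iff fun X => by
    rw [le_himp_iff, le_principal_iff, le_principal_iff]
    refine ⟨fun h C hC => ?_, fun h C hC => le_imp_iff.2 (h _ ?_)⟩
    · exact (le_and_iff.2 ⟨le_rfl, hC.2⟩).trans (le_imp_iff.1 (h C hC.1))
    · exact ⟨X.1.lower (Provable.and_left _ _) hC, Provable.and_right _ _⟩

theorem principal_all (A : Formula) : principal (all A) = ⨅ t, principal (A.inst t) :=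
  eq_of_forall_le_iff fun X => by
    simp only [le_iInf_iff, le_principal_iff, le_all_iff]
    exact ⟨fun h t B hB => h B hB t, fun h B hB t => h t B hB⟩

theorem principal_ex (A : Formula) : principal (ex A) = ⨆ t, principal (A.inst t) :=
  eq_of_forall_ge_iff fun X => by
    simp only [iSup_le_iff, principal_le_iff]
    exact ⟨fun h t => X.1.lower (Provable.ex_intro _ t) h,
      fun h => mem_iff.2 fun C hC => ex_le_iff.2 fun t => hC _ (h t)⟩

theorem provable_of_principal_eq_top {A : Formula} (h : principal A = ⊤) : Provable A := by
  have h' : principal (imp A A) ≤ principal A := h ▸ le_top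
  exact .mp (principal_le_iff.1 h') (.refl A)

/-- The model of QHC in which the problems of QH take their classes as values. -/
def canonicalModel : QHC.Model (QHC.TruthValue macNeille) :=
  .ofFrame fun n i ts => principal (atom n i ts)

/-- The domain consists of the variables, so extending the environment by t amounts to instantiating
the renamed scope at t. -/
theorem eval_canonicalModel (A : Formula) (ρ : ℕ → ℕ) :
    canonicalModel.eval ρ A.toQHC = principal (A.rename ρ) := by
  induction A generalizing ρ with
  | atom => rfl
  | falsum => exact principal_falsum.symm
  | and A B ihA ihB =>
    rw [Formula.rename, principal_and, ← ihA, ← ihB]; rfl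
  | or A B ihA ihB =>
    rw [Formula.rename, principal_or, ← ihA, ← ihB]; rfl
  | imp A B ihA ihB =>
    rw [Formula.rename, principal_imp, ← ihA, ← ihB]; rfl
  | all A ih =>
    simp only [Formula.rename, principal_all, inst, rename_rename,
      instRenaming_comp_liftRenaming, ← ih]
    rfl
  | ex A ih =>
    simp only [Formula.rename, principal_ex, inst, rename_rename,
      instRenaming_comp_liftRenaming, ← ih]
    rfl

/-- Soundness in the canonical model, where translation does not change values. -/
theorem provable_of_nablaTranslation {A : Formula}
    (h : QHC.Provable A.toQHC.nablaTranslation) : Provable A := by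
  have h' := canonicalModel.eval_eq_top h id
  rw [QHC.Model.eval_nablaTranslation, eval_canonicalModel, rename_id] at h'
  exact provable_of_principal_eq_top h'

end QH

/-- The `∇`-interpretation: it preserves provability in QHC (and types, by its typing), reflects
provability in QHC on the formulas of QH and of QS4, and so is a faithful interpretation
of the calculus QH in the calculus QHC. -/
theorem mainTheorem6 :
    (∀ (k : QHC.Kind) (A : QHC.Formula k), QHC.Provable A → QHC.Provable A.nablaTranslation) ∧
    (∀ A : QH.Formula, QHC.Provable A.toQHC.nablaTranslation → QHC.Provable A.toQHC) ∧
    (∀ A : QHC.Formula QHC.Kind.proposition, A.IsQS4 →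
      QHC.Provable A.nablaTranslation → QHC.Provable A) ∧
    (∀ A : QH.Formula, QH.Provable A ↔ QHC.Provable A.toQHC.nablaTranslation) :=
  ⟨fun _ _ h => h.nablaTranslation,
    fun _ h => (QH.provable_of_nablaTranslation h).toQHC,
    fun _ hA h => hA.nablaTranslation_eq ▸ h,
    fun _ => ⟨fun h => h.toQHC.nablaTranslation, QH.provable_of_nablaTranslation⟩⟩
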